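/- For integers $k,q\ge 2$ let $B(k,q)$ be the de Bruijn digraph with vertex set $\{0,1,\dots,q-1\}^k$ and with an edge $x_1x_2\cdots x_k\to x_2x_3\cdots x_k\,y$ for every word $x_1\cdots x_k$ and every letter $y$. Let $\alpha(k,q)$ be the independence number of the simple graph obtained from $B(k,q)$ by forgetting orientations and deleting self-loops, and let $\alpha_{\mathrm{loop}}(k,q)$ be the independence number when self-loops are retained, that is, the maximal size of a set $J$ of vertices such that $x\to y$ holds for no $x,y\in J$, whether or not $x=y$. For $m\ge 1$ and Lebesgue measurable $A\subseteq[0,1]^m$ put $$\Phi_m(A)=\int_{[0,1]^{m+1}}\mathbf 1_A(x_1,\dots,x_m)\bigl(1-\mathbf 1_A(x_2,\dots,x_{m+1})\bigr)\,dx_1\cdots dx_{m+1},\qquad \lambda_m=\sup\{\Phi_m(A): A\subseteq[0,1]^m\text{ Lebesgue measurable}\}.$$ **Theorem.** One has $$\frac38<\frac{91}{240}\le\lambda_3\le\frac{11}{28}<\frac25,$$ and, as $q\to\infty$, $$\alpha(4,q)=\lambda_3q^4+o(q^4).$$ Consequently, $$\frac{91}{240}q^4+o(q^4)\le\alpha(4,q)\le\frac{11}{28}q^4+o(q^4).$$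 The same asymptotic formula and the same two-sided bounds hold for $\alpha_{\mathrm{loop}}(4,q)$. -/

import Mathlib

open MeasureTheory Filter Asymptotics

/-- The de Bruijn digraph `B(k, q)`: its vertices are the words of length `k` over the alphabet
`{0, …, q - 1}`, and `x₁x₂…x_k → x₂x₃…x_k y` for every letter `y`. In particular the constant
words carry loops. -/
def deBruijnDigraph (k q : ℕ) : Digraph (Fin k → Fin q) where
  Adj x y := ∀ i j : Fin k, (j : ℕ) = (i : ℕ) + 1 → y i = x j

/-- The simple graph underlying the de Bruijn digraph: orientations are forgotten and the
self-loops are deleted. -/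
def deBruijnGraph (k q : ℕ) : SimpleGraph (Fin k → Fin q) :=
  (deBruijnDigraph k q).toSimpleGraphInclusive

/-- `α(k, q)`: the independence number of the simple (loopless) de Bruijn graph. -/
noncomputable def deBruijnAlpha (k q : ℕ) : ℕ :=
  (deBruijnGraph k q).indepNum

/-- A set of words that is independent in the de Bruijn graph with self-loops retained: there is
no edge between two of its elements, equal or not, so that it contains no looped vertex. -/
def IsLoopIndep (k q : ℕ) (s : Finset (Fin k → Fin q)) : Prop :=
  ∀ x ∈ s, ∀ y ∈ s, ¬ (deBruijnDigraph k q).Adj x y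

/-- `α_loop(k, q)`: the independence number of the de Bruijn graph with self-loops retained. -/
noncomputable def deBruijnAlphaLoop (k q : ℕ) : ℕ :=
  sSup {n : ℕ | ∃ s : Finset (Fin k → Fin q), IsLoopIndep k q s ∧ s.card = n}

/-- `Φ_m(A) = ∫_{[0,1]^{m+1}} 1_A(x₁,…,x_m) (1 - 1_A(x₂,…,x_{m+1})) dx₁ ⋯ dx_{m+1}`. -/
noncomputable def cubePhi (m : ℕ) (A : Set (Fin m → ℝ)) : ℝ :=
  ∫ x in Set.Icc (0 : Fin (m + 1) → ℝ) 1,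
    A.indicator (fun _ => (1 : ℝ)) (fun i => x i.castSucc) *
      (1 - A.indicator (fun _ => (1 : ℝ)) (fun i => x i.succ))

/-- `λ_m`: the supremum of `Φ_m(A)` over the Lebesgue measurable sets `A ⊆ [0,1]^m`. -/
noncomputable def cubeLambda (m : ℕ) : ℝ :=
  sSup {r : ℝ | ∃ A : Set (Fin m → ℝ),
    A ⊆ Set.Icc 0 1 ∧ NullMeasurableSet A volume ∧ cubePhi m A = r}

/-! The discrete and continuous problems agree up to `O(q ^ 3)`. Replacing letters by intervals of
length `1/q` turns a loop-independent set into a set `A` of 3-letter prefixes, so `α_loop ≤ λ₃ q⁴`.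
Conversely, sampling `q` uniform points turns `A` into a random loop-independent set, so
`q(q-1)(q-2)(q-3) λ₃ ≤ α_loop`. Loops cost at most `q` vertices.

For `λ₃ ≤ 11/28`, place seven independent uniform points on a cycle and let `b i` record whether the
window of three starting at `i` lies in `A`. Windows `i` and `i + 3` are disjoint, so their bits
agree with probability `p² + (1 - p)² ≥ 1/2`, whereas many steps from 1 to 0 force disagreements
(`cyclic_seven_ascents_add_coincidences_le`). For `91/240 ≤ λ₃`, blow up an explicit set over nine
letters. -/

/-! ### An explicit independent set over nine letters -/

theorem finFunctionFinEquiv_four_val {q : ℕ} (x : Fin 4 → Fin q) :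
    (finFunctionFinEquiv x : ℕ) = x 0 + x 1 * q + x 2 * q ^ 2 + x 3 * q ^ 3 := by
  rw [finFunctionFinEquiv_apply, Fin.sum_univ_four]
  simp

/-- A set of words over nine letters, in which the word `x₁x₂x₃` is encoded by the bit number
`x₁ + 9 x₂ + 81 x₃` of a numeral. -/
def nineLetterBit (n : ℕ) : Bool :=
  Nat.testBit 0x131ffde440309cffffe31004e6720000002733900003ff390000001ffff802f3fffd883fbfdffffefb79ffde44030bcfffff799cffef220180e7ffff1880273390000001399c80001399c80000009cce40179ffde44030bcffffe31 n

/-- The words of length four over nine letters whose prefix of length three is in the set encoded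
by `nineLetterBit`, and whose suffix of length three is not. -/
def nineLetterWords : Finset (Fin 4 → Fin 9) :=
  Finset.univ.filter fun x =>
    nineLetterBit (x 0 + 9 * x 1 + 81 * x 2) && !nineLetterBit (x 1 + 9 * x 2 + 81 * x 3)

theorem isLoopIndep_nineLetterWords : IsLoopIndep 4 9 nineLetterWords := by
  intro x hx y hy hxy
  simp only [nineLetterWords, Finset.mem_filter, Finset.mem_univ, true_and, Bool.and_eq_true,
    Bool.not_eq_true'] at hx hy
  rw [hxy 0 1 rfl, hxy 1 2 rfl, hxy 2 3 rfl, hx.2] at hy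
  exact Bool.false_ne_true hy.1

/-- The density `2488 / 9 ^ 4` slightly exceeds `91 / 240`. -/
theorem card_nineLetterWords : nineLetterWords.card = 2488 := by
  -- Words become base-9 numerals, lowest digit first: `n % 729` is the prefix and `n / 9` the
  -- suffix, which leaves a count the kernel can evaluate.
  have h : nineLetterWords.card = ((List.range 6561).filter fun n =>
      nineLetterBit (n % 729) && !nineLetterBit (n / 9)).length := by
    rw [← List.toFinset_card_of_nodup (List.nodup_range.filter _)]
    refine Finset.card_bij (fun x _ => (finFunctionFinEquiv x : ℕ)) ?_ ?_ ?_
    · intro x hx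
      have h0 := (x 0).isLt
      have h1 := (x 1).isLt
      have h2 := (x 2).isLt
      have h3 := (x 3).isLt
      simp only [nineLetterWords, Finset.mem_filter, Finset.mem_univ, true_and] at hx
      have hc := finFunctionFinEquiv_four_val x
      simp only [List.mem_toFinset, List.mem_filter, List.mem_range, hc]
      refine ⟨by omega, ?_⟩
      convert hx using 4 <;> omega
    · intro x _ y _ hxy
      exact finFunctionFinEquiv.injective (Fin.ext hxy)
    · intro n hn
      simp only [List.mem_toFinset, List.mem_filter, List.mem_range] at hn
      obtain ⟨x, hx⟩ := finFunctionFinEquiv.surjective (⟨n, hn.1⟩ : Fin (9 ^ 4))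
      have h0 := (x 0).isLt
      have h1 := (x 1).isLt
      have h2 := (x 2).isLt
      have h3 := (x 3).isLt
      have hc := finFunctionFinEquiv_four_val x
      rw [hx] at hc
      dsimp only at hc
      refine ⟨x, ?_, by rw [hx]⟩
      simp only [nineLetterWords, Finset.mem_filter, Finset.mem_univ, true_and]
      convert hn.2 using 4 <;> omega
  rw [h]
  decide +kernel

/-! ### Comparison of the two independence numbers -/

theorem deBruijnAlphaLoop_set_bddAbove (k q : ℕ) :
    BddAbove {n : ℕ | ∃ s : Finset (Fin k → Fin q), IsLoopIndep k q s ∧ s.card = n} := by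
  refine ⟨Fintype.card (Fin k → Fin q), ?_⟩
  rintro _ ⟨s, -, rfl⟩
  exact s.card_le_univ

theorem IsLoopIndep.card_le_deBruijnAlphaLoop {k q : ℕ} {s : Finset (Fin k → Fin q)}
    (hs : IsLoopIndep k q s) : s.card ≤ deBruijnAlphaLoop k q :=
  le_csSup (deBruijnAlphaLoop_set_bddAbove k q) ⟨s, hs, rfl⟩

theorem exists_isLoopIndep_card_eq_deBruijnAlphaLoop (k q : ℕ) :
    ∃ s : Finset (Fin k → Fin q), IsLoopIndep k q s ∧ s.card = deBruijnAlphaLoop k q :=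
  Nat.sSup_mem (s := {n : ℕ | ∃ s : Finset (Fin k → Fin q), IsLoopIndep k q s ∧ s.card = n})
    ⟨0, ∅, by simp [IsLoopIndep], rfl⟩ (deBruijnAlphaLoop_set_bddAbove k q)

theorem deBruijnGraph_adj {k q : ℕ} {x y : Fin k → Fin q} :
    (deBruijnGraph k q).Adj x y ↔
      x ≠ y ∧ ((deBruijnDigraph k q).Adj x y ∨ (deBruijnDigraph k q).Adj y x) := Iff.rfl

theorem deBruijnAlphaLoop_le_deBruijnAlpha (k q : ℕ) :
    deBruijnAlphaLoop k q ≤ deBruijnAlpha k q := by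
  obtain ⟨s, hs, hcard⟩ := exists_isLoopIndep_card_eq_deBruijnAlphaLoop k q
  rw [← hcard]
  refine SimpleGraph.IsIndepSet.card_le_indepNum (G := deBruijnGraph k q) ?_
  intro x hx y hy _ hxy
  exact (deBruijnGraph_adj.1 hxy).2.elim (hs x hx y hy) (hs y hy x hx)

/-- The only looped words are the constant ones. -/
theorem eq_const_of_deBruijnDigraph_adj_self {k q : ℕ} {x : Fin (k + 1) → Fin q}
    (hx : (deBruijnDigraph (k + 1) q).Adj x x) (i : Fin (k + 1)) : x i = x 0 := by
  induction i using Fin.induction with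
  | zero => rfl
  | succ i ih => rw [← ih]; exact (hx i.castSucc i.succ (by simp)).symm

/-- Discarding the looped words from an independent set loses at most the `q` constant words. -/
theorem deBruijnAlpha_le_deBruijnAlphaLoop_add (k q : ℕ) :
    deBruijnAlpha (k + 1) q ≤ deBruijnAlphaLoop (k + 1) q + q := by
  classical
  obtain ⟨s, hs, hcard⟩ := (deBruijnGraph (k + 1) q).exists_isNIndepSet_indepNum
  rw [deBruijnAlpha, ← hcard,
    ← s.card_filter_add_card_filter_not (fun x => ¬ (deBruijnDigraph (k + 1) q).Adj x x)]
  refine add_le_add (IsLoopIndep.card_le_deBruijnAlphaLoop ?_) ?_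
  · intro x hx y hy hxy
    rw [Finset.mem_filter] at hx hy
    by_cases h : x = y
    · subst h
      exact hx.2 hxy
    · exact hs hx.1 hy.1 h (deBruijnGraph_adj.2 ⟨h, Or.inl hxy⟩)
  · calc _ ≤ (Finset.univ : Finset (Fin q)).card := by
          refine Finset.card_le_card_of_injOn (fun x => x 0) (fun _ _ => Finset.mem_univ _) ?_
          intro x hx y hy hxy
          simp only [not_not, Finset.coe_filter, Set.mem_ofPred_eq] at hx hy
          funext i
          rw [eq_const_of_deBruijnDigraph_adj_self hx.2, eq_const_of_deBruijnDigraph_adj_self hy.2]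
          exact hxy
      _ = q := by simp

/-! ### Uniform measure on cubes and coordinate projections -/

/-- The uniform measure on the cube `[0,1]^ι`, as a measure on `ι → ℝ`. -/
noncomputable def cubeMeasure (ι : Type*) [Fintype ι] : Measure (ι → ℝ) :=
  Measure.pi fun _ => volume.restrict (Set.Icc (0 : ℝ) 1)

instance unitInterval_restrict_isProbabilityMeasure :
    IsProbabilityMeasure (volume.restrict (Set.Icc (0 : ℝ) 1)) :=
  ⟨by simp⟩

instance cubeMeasure_isProbabilityMeasure (ι : Type*) [Fintype ι] :
    IsProbabilityMeasure (cubeMeasure ι) := by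
  unfold cubeMeasure
  infer_instance

theorem volume_restrict_Icc_eq_cubeMeasure (ι : Type*) [Fintype ι] :
    (volume : Measure (ι → ℝ)).restrict (Set.Icc 0 1) = cubeMeasure ι := by
  rw [cubeMeasure, ← Measure.restrict_pi_pi, ← volume_pi]
  congr 1
  exact (Set.pi_univ_Icc 0 1).symm

theorem nullMeasurableSet_cubeMeasure {ι : Type*} [Fintype ι] {A : Set (ι → ℝ)}
    (hA : NullMeasurableSet A volume) : NullMeasurableSet A (cubeMeasure ι) := by
  rw [← volume_restrict_Icc_eq_cubeMeasure]
  exact hA.mono_ac Measure.restrict_le_self.absolutelyContinuous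

theorem measurePreserving_cubeMeasure_comp {ι κ : Type*} [Fintype ι] [Fintype κ] {σ : κ → ι}
    (hσ : Function.Injective σ) :
    MeasurePreserving (fun t : ι → ℝ => t ∘ σ) (cubeMeasure ι) (cubeMeasure κ) := by
  classical
  have hm : Measurable fun t : ι → ℝ => t ∘ σ :=
    measurable_pi_lambda _ fun j => measurable_pi_apply _
  refine ⟨hm, (Measure.pi_eq fun s hs => ?_).symm⟩
  rw [Measure.map_apply hm (MeasurableSet.univ_pi hs)]
  -- The preimage of a box is a box; coordinates outside the range of `σ` are unconstrained and
  -- contribute a factor 1.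
  have hpre : (fun t : ι → ℝ => t ∘ σ) ⁻¹' Set.univ.pi s =
      Set.univ.pi fun i => {y | ∀ j, σ j = i → y ∈ s j} := by
    ext t
    simp only [Set.mem_preimage, Set.mem_univ_pi, Function.comp_apply, Set.mem_ofPred_eq]
    exact ⟨fun h i j hj => hj ▸ h j, fun h j => h _ j rfl⟩
  rw [hpre, cubeMeasure, Measure.pi_pi]
  symm
  refine Fintype.prod_of_injective σ hσ _ _ ?_ ?_
  · intro i hi
    have : {y : ℝ | ∀ j, σ j = i → y ∈ s j} = Set.univ :=
      Set.eq_univ_of_forall fun y j hj => (hi ⟨j, by simpa using hj⟩).elim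
    rw [this, measure_univ]
  · intro j
    congr 1
    ext y
    simp only [Set.mem_ofPred_eq]
    exact ⟨fun h j' hj' => hσ hj' ▸ h, fun h => h j rfl⟩

/-- Injectivity of `Sum.elim σ τ` says that the two coordinate families are disjoint, which gives
independence. -/
theorem measurePreserving_cubeMeasure_comp_prod {ι κ κ' : Type*} [Fintype ι] [Fintype κ]
    [Fintype κ'] {σ : κ → ι} {τ : κ' → ι} (h : Function.Injective (Sum.elim σ τ)) :
    MeasurePreserving (fun t : ι → ℝ => (t ∘ σ, t ∘ τ)) (cubeMeasure ι)
      ((cubeMeasure κ).prod (cubeMeasure κ')) :=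
  (measurePreserving_sumPiEquivProdPi
    fun _ : κ ⊕ κ' => volume.restrict (Set.Icc (0 : ℝ) 1)).comp
    (measurePreserving_cubeMeasure_comp h)

/-- The points `(x₁,…,x_{m+1})` with `(x₁,…,x_m) ∈ A` and `(x₂,…,x_{m+1}) ∉ A`. -/
def shiftCut {m : ℕ} (A : Set (Fin m → ℝ)) : Set (Fin (m + 1) → ℝ) :=
  {x | x ∘ Fin.castSucc ∈ A ∧ x ∘ Fin.succ ∉ A}

theorem nullMeasurableSet_shiftCut {m : ℕ} {A : Set (Fin m → ℝ)}
    (hA : NullMeasurableSet A volume) :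
    NullMeasurableSet (shiftCut A) (cubeMeasure (Fin (m + 1))) :=
  ((nullMeasurableSet_cubeMeasure hA).preimage (measurePreserving_cubeMeasure_comp
    (Fin.castSucc_injective m)).quasiMeasurePreserving).inter
  ((nullMeasurableSet_cubeMeasure hA).preimage (measurePreserving_cubeMeasure_comp
    (Fin.succ_injective m)).quasiMeasurePreserving).compl

theorem cubePhi_eq_measureReal_shiftCut {m : ℕ} {A : Set (Fin m → ℝ)}
    (hA : NullMeasurableSet A volume) :
    cubePhi m A = (cubeMeasure (Fin (m + 1))).real (shiftCut A) := by
  have h : ∀ x : Fin (m + 1) → ℝ,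
      A.indicator (fun _ => (1 : ℝ)) (fun i => x i.castSucc) *
        (1 - A.indicator (fun _ => (1 : ℝ)) (fun i => x i.succ)) =
      (shiftCut A).indicator (fun _ => (1 : ℝ)) x := by
    intro x
    by_cases h₁ : (fun i : Fin m => x i.castSucc) ∈ A <;>
      by_cases h₂ : (fun i : Fin m => x i.succ) ∈ A <;>
      simp [shiftCut, Set.indicator, Function.comp_def, h₁, h₂]
  simp only [cubePhi, h, volume_restrict_Icc_eq_cubeMeasure]
  rw [integral_indicator₀ (nullMeasurableSet_shiftCut hA)]
  simp

theorem measureReal_comp_mem_shiftCut {m : ℕ} {ι : Type*} [Fintype ι] {A : Set (Fin m → ℝ)}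
    (hA : NullMeasurableSet A volume) {σ : Fin (m + 1) → ι} (hσ : Function.Injective σ) :
    (cubeMeasure ι).real {t | t ∘ σ ∈ shiftCut A} = cubePhi m A := by
  rw [cubePhi_eq_measureReal_shiftCut hA, measureReal_def, measureReal_def,
    ← (measurePreserving_cubeMeasure_comp hσ).measure_preimage (nullMeasurableSet_shiftCut hA)]
  rfl

theorem measureReal_comp_mem_and_comp_mem {ι κ κ' : Type*} [Fintype ι] [Fintype κ] [Fintype κ']
    {A : Set (κ → ℝ)} {B : Set (κ' → ℝ)} (hA : NullMeasurableSet A (cubeMeasure κ))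
    (hB : NullMeasurableSet B (cubeMeasure κ'))
    {σ : κ → ι} {τ : κ' → ι} (h : Function.Injective (Sum.elim σ τ)) :
    (cubeMeasure ι).real {t | t ∘ σ ∈ A ∧ t ∘ τ ∈ B} =
      (cubeMeasure κ).real A * (cubeMeasure κ').real B := by
  rw [← measureReal_prod_prod, measureReal_def, measureReal_def,
    ← (measurePreserving_cubeMeasure_comp_prod h).measure_preimage (hA.prod hB)]
  rfl

/-! ### The upper bound from a seven-cycle -/

/-- In a cyclic binary word of length seven, the number of ascents and the number of coincidences
at distance three cannot both be large. -/
theorem cyclic_seven_ascents_add_coincidences_le : ∀ b : Fin 7 → Bool,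
    2 * (∑ i, (b i && !b (i + 1)).toNat) + ∑ i, (b i == b (i + 3)).toNat ≤ 9 := by
  -- At most three steps from 1 to 0 fit. Since `i ↦ i + 3` is a single 7-cycle, disagreements are
  -- even in number: at least two if `b` is not constant. With three such steps `b` alternates
  -- except for one repeated pair, leaving exactly three coincidences.
  decide +kernel

theorem cubePhi_three_le {A : Set (Fin 3 → ℝ)} (hA : NullMeasurableSet A volume) :
    cubePhi 3 A ≤ 11 / 28 := by
  classical
  let w : Fin 7 → Fin 3 → Fin 7 := fun i j => i + j.castLE (by norm_num)
  let w₄ : Fin 7 → Fin 4 → Fin 7 := fun i j => i + j.castLE (by norm_num)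
  have hw : ∀ i, Function.Injective (w i) := by decide +kernel
  have hw₄ : ∀ i, Function.Injective (w₄ i) := by decide +kernel
  have hww : ∀ i, Function.Injective (Sum.elim (w i) (w (i + 3))) := by decide +kernel
  have hw_castSucc : ∀ i j, w₄ i (Fin.castSucc j) = w i j := by decide +kernel
  have hw_succ : ∀ i j, w₄ i (Fin.succ j) = w (i + 1) j := by decide +kernel
  let μ := cubeMeasure (Fin 7)
  have hA' := nullMeasurableSet_cubeMeasure hA
  let C : Fin 7 → Set (Fin 7 → ℝ) := fun i => {t | t ∘ w₄ i ∈ shiftCut A}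
  let D₁ : Fin 7 → Set (Fin 7 → ℝ) := fun i => {t | t ∘ w i ∈ A ∧ t ∘ w (i + 3) ∈ A}
  let D₀ : Fin 7 → Set (Fin 7 → ℝ) := fun i => {t | t ∘ w i ∈ Aᶜ ∧ t ∘ w (i + 3) ∈ Aᶜ}
  have hC : ∀ i, NullMeasurableSet (C i) μ := fun i =>
    (nullMeasurableSet_shiftCut hA).preimage
      (measurePreserving_cubeMeasure_comp (hw₄ i)).quasiMeasurePreserving
  have hZ : ∀ i, NullMeasurableSet {t : Fin 7 → ℝ | t ∘ w i ∈ A} μ := fun i =>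
    hA'.preimage (measurePreserving_cubeMeasure_comp (hw i)).quasiMeasurePreserving
  have hD₁ : ∀ i, NullMeasurableSet (D₁ i) μ := fun i => (hZ i).inter (hZ (i + 3))
  have hD₀ : ∀ i, NullMeasurableSet (D₀ i) μ := fun i => (hZ i).compl.inter (hZ (i + 3)).compl
  have hint : ∀ {S : Set (Fin 7 → ℝ)}, NullMeasurableSet S μ →
      Integrable (S.indicator fun _ => (1 : ℝ)) μ := fun hS =>
    (integrable_const (1 : ℝ)).indicator₀ hS
  have hval : ∀ {S : Set (Fin 7 → ℝ)}, NullMeasurableSet S μ →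
      ∫ t, S.indicator (fun _ => (1 : ℝ)) t ∂μ = μ.real S := fun hS => by
    rw [integral_indicator₀ hS]
    simp
  have hpt : ∀ t : Fin 7 → ℝ, ∑ i, (2 * (C i).indicator (fun _ => (1 : ℝ)) t +
      ((D₁ i).indicator (fun _ => (1 : ℝ)) t + (D₀ i).indicator (fun _ => (1 : ℝ)) t)) ≤ 9 := by
    intro t
    let b : Fin 7 → Bool := fun i => decide (t ∘ w i ∈ A)
    have h₁ : ∀ i, (C i).indicator (fun _ => (1 : ℝ)) t = ((b i && !b (i + 1)).toNat : ℝ) := by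
      intro i
      have e₁ : (t ∘ w₄ i) ∘ Fin.castSucc = t ∘ w i := funext fun j => congrArg t (hw_castSucc i j)
      have e₂ : (t ∘ w₄ i) ∘ Fin.succ = t ∘ w (i + 1) := funext fun j => congrArg t (hw_succ i j)
      by_cases p : t ∘ w i ∈ A <;> by_cases r : t ∘ w (i + 1) ∈ A <;>
        simp [C, b, shiftCut, Set.indicator, e₁, e₂, p, r]
    have h₂ : ∀ i, (D₁ i).indicator (fun _ => (1 : ℝ)) t + (D₀ i).indicator (fun _ => (1 : ℝ)) t =
        ((b i == b (i + 3)).toNat : ℝ) := by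
      intro i
      by_cases p : t ∘ w i ∈ A <;> by_cases r : t ∘ w (i + 3) ∈ A <;>
        simp [D₁, D₀, b, Set.indicator, p, r]
    simp only [h₁, h₂]
    rw [Finset.sum_add_distrib, ← Finset.mul_sum]
    exact_mod_cast cyclic_seven_ascents_add_coincidences_le b
  have hterm_int : ∀ i, Integrable (fun t => 2 * (C i).indicator (fun _ => (1 : ℝ)) t +
      ((D₁ i).indicator (fun _ => (1 : ℝ)) t + (D₀ i).indicator (fun _ => (1 : ℝ)) t)) μ :=
    fun i => ((hint (hC i)).const_mul 2).add ((hint (hD₁ i)).add (hint (hD₀ i)))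
  have hbound : ∑ i, (2 * μ.real (C i) + (μ.real (D₁ i) + μ.real (D₀ i))) ≤ 9 := by
    calc _ = ∫ t, ∑ i, (2 * (C i).indicator (fun _ => (1 : ℝ)) t +
        ((D₁ i).indicator (fun _ => (1 : ℝ)) t + (D₀ i).indicator (fun _ => (1 : ℝ)) t)) ∂μ := by
          rw [integral_finsetSum _ fun i _ => hterm_int i]
          refine Finset.sum_congr rfl fun i _ => ?_
          have hD : Integrable (fun t => (D₁ i).indicator (fun _ => (1 : ℝ)) t +
              (D₀ i).indicator (fun _ => (1 : ℝ)) t) μ := (hint (hD₁ i)).add (hint (hD₀ i))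
          rw [integral_add ((hint (hC i)).const_mul 2) hD, integral_add (hint (hD₁ i)) (hint (hD₀ i)), integral_const_mul, hval (hC i),
            hval (hD₁ i), hval (hD₀ i)]
      _ ≤ ∫ _, (9 : ℝ) ∂μ := by
          exact integral_mono (integrable_finsetSum _ fun i _ => hterm_int i)
            (integrable_const _) hpt
      _ = 9 := by simp [μ]
  have hterm : ∀ i, 2 * cubePhi 3 A + 1 / 2 ≤
      2 * μ.real (C i) + (μ.real (D₁ i) + μ.real (D₀ i)) := by
    intro i
    have e : (cubeMeasure (Fin 3)).real Aᶜ = 1 - (cubeMeasure (Fin 3)).real A :=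
      probReal_compl_eq_one_sub₀ hA'
    rw [measureReal_comp_mem_shiftCut hA (hw₄ i),
      measureReal_comp_mem_and_comp_mem hA' hA' (hww i),
      measureReal_comp_mem_and_comp_mem hA'.compl hA'.compl (hww i), e]
    -- This is `p² + (1 - p)² ≥ 1/2`; summing over `i` gives `7 (2 Φ + 1/2) ≤ 9`.
    nlinarith [sq_nonneg (2 * (cubeMeasure (Fin 3)).real A - 1)]
  have hsum := (Finset.sum_le_sum fun i (_ : i ∈ Finset.univ) => hterm i).trans hbound
  rw [Finset.sum_const, Finset.card_univ, Fintype.card_fin, nsmul_eq_mul] at hsum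
  push_cast at hsum
  linarith

/-! ### Transfer between words and the cube -/

theorem deBruijnDigraph_adj_iff {m q : ℕ} {x y : Fin (m + 1) → Fin q} :
    (deBruijnDigraph (m + 1) q).Adj x y ↔ y ∘ Fin.castSucc = x ∘ Fin.succ := by
  constructor
  · intro h
    funext i
    exact h i.castSucc i.succ (by simp)
  · intro h i j hij
    have hi : (i : ℕ) < m := by omega
    have := congrFun h ⟨i, hi⟩
    have e : (Fin.succ ⟨i, hi⟩ : Fin (m + 1)) = j := Fin.ext hij.symm
    rwa [Function.comp_apply, Function.comp_apply, e] at this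

/-- Sampling the letters as independent uniform points of `[0,1]` bounds `Φ_m(A)` by the
independence number. -/
theorem descFactorial_mul_cubePhi_le {m : ℕ} (q : ℕ) {A : Set (Fin m → ℝ)}
    (hA : NullMeasurableSet A volume) :
    (q.descFactorial (m + 1) : ℝ) * cubePhi m A ≤ deBruijnAlphaLoop (m + 1) q := by
  classical
  -- Only words with distinct letters are counted, since their sampled points are independent; there
  -- are `q.descFactorial (m + 1)` of them.
  let C : (Fin (m + 1) ↪ Fin q) → Set (Fin q → ℝ) := fun f => {t | t ∘ f ∈ shiftCut A}
  have hC : ∀ f, NullMeasurableSet (C f) (cubeMeasure (Fin q)) := fun f =>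
    (nullMeasurableSet_shiftCut hA).preimage
      (measurePreserving_cubeMeasure_comp f.injective).quasiMeasurePreserving
  have hint : ∀ f, Integrable ((C f).indicator fun _ => (1 : ℝ)) (cubeMeasure (Fin q)) :=
    fun f => (integrable_const (1 : ℝ)).indicator₀ (hC f)
  have hpt : ∀ t, ∑ f, (C f).indicator (fun _ => (1 : ℝ)) t ≤ deBruijnAlphaLoop (m + 1) q := by
    intro t
    let s : Finset (Fin (m + 1) → Fin q) := Finset.univ.filter fun x => t ∘ x ∈ shiftCut A
    have hs : IsLoopIndep (m + 1) q s := by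
      intro x hx y hy hxy
      rw [Finset.mem_filter] at hx hy
      have h := hy.2.1
      rw [Function.comp_assoc, deBruijnDigraph_adj_iff.1 hxy, ← Function.comp_assoc] at h
      exact hx.2.2 h
    calc ∑ f, (C f).indicator (fun _ => (1 : ℝ)) t
        = ((Finset.univ.filter fun f => t ∈ C f).card : ℝ) := by
          simp [Set.indicator_apply, Finset.sum_boole]
      _ ≤ (s.card : ℝ) := by
          refine Nat.cast_le.2 (Finset.card_le_card_of_injOn (fun f => ⇑f) ?_
            DFunLike.coe_injective.injOn)
          intro f hf
          rw [Finset.mem_coe, Finset.mem_filter] at hf ⊢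
          exact ⟨Finset.mem_univ _, hf.2⟩
      _ ≤ deBruijnAlphaLoop (m + 1) q := Nat.cast_le.2 hs.card_le_deBruijnAlphaLoop
  calc (q.descFactorial (m + 1) : ℝ) * cubePhi m A
      = ∑ f, ∫ t, (C f).indicator (fun _ => (1 : ℝ)) t ∂cubeMeasure (Fin q) := by
        have h : ∀ f, ∫ t, (C f).indicator (fun _ => (1 : ℝ)) t ∂cubeMeasure (Fin q) =
            cubePhi m A := fun f => by
          rw [integral_indicator₀ (hC f), ← measureReal_comp_mem_shiftCut hA f.injective]
          simp [C]
        simp only [h, Finset.sum_const, Finset.card_univ, Fintype.card_embedding_eq,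
          Fintype.card_fin, nsmul_eq_mul]
    _ = ∫ t, ∑ f, (C f).indicator (fun _ => (1 : ℝ)) t ∂cubeMeasure (Fin q) :=
        (integral_finsetSum _ fun f _ => hint f).symm
    _ ≤ ∫ _, (deBruijnAlphaLoop (m + 1) q : ℝ) ∂cubeMeasure (Fin q) :=
        integral_mono (integrable_finsetSum _ fun f _ => hint f) (integrable_const _) hpt
    _ = deBruijnAlphaLoop (m + 1) q := by simp

/-- The `c`-th of the `q` intervals of equal length into which `[0,1)` is divided. -/
def letterInterval {q : ℕ} (c : Fin q) : Set ℝ := Set.Ico ((c : ℝ) / q) (((c : ℝ) + 1) / q)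

theorem measurableSet_letterInterval {q : ℕ} (c : Fin q) : MeasurableSet (letterInterval c) :=
  measurableSet_Ico

theorem letterInterval_subset {q : ℕ} (c : Fin q) : letterInterval c ⊆ Set.Icc 0 1 := by
  have hq : (0 : ℝ) < q := Nat.cast_pos.2 c.pos
  have hc : (c : ℝ) + 1 ≤ q := by exact_mod_cast c.isLt
  intro y hy
  exact ⟨le_trans (by positivity) hy.1, hy.2.le.trans ((div_le_one hq).2 hc)⟩

theorem eq_of_mem_letterInterval {q : ℕ} {c d : Fin q} {y : ℝ} (hc : y ∈ letterInterval c)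
    (hd : y ∈ letterInterval d) : c = d := by
  have hq : (0 : ℝ) < q := Nat.cast_pos.2 c.pos
  have h₁ : (c : ℝ) < d + 1 := (div_lt_div_iff_of_pos_right hq).1 (hc.1.trans_lt hd.2)
  have h₂ : (d : ℝ) < c + 1 := (div_lt_div_iff_of_pos_right hq).1 (hd.1.trans_lt hc.2)
  have h₁' : (c : ℕ) < d + 1 := by exact_mod_cast h₁
  have h₂' : (d : ℕ) < c + 1 := by exact_mod_cast h₂
  exact Fin.ext (by omega)

/-- The product of the intervals of the letters of a word. -/
def wordBox {n q : ℕ} (x : Fin n → Fin q) : Set (Fin n → ℝ) :=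
  Set.univ.pi fun i => letterInterval (x i)

theorem measurableSet_wordBox {n q : ℕ} (x : Fin n → Fin q) : MeasurableSet (wordBox x) :=
  MeasurableSet.univ_pi fun _ => measurableSet_letterInterval _

theorem eq_of_mem_wordBox {n q : ℕ} {x y : Fin n → Fin q} {t : Fin n → ℝ} (hx : t ∈ wordBox x)
    (hy : t ∈ wordBox y) : x = y :=
  funext fun i => eq_of_mem_letterInterval (hx i trivial) (hy i trivial)

theorem measureReal_wordBox {n q : ℕ} (x : Fin n → Fin q) :
    (cubeMeasure (Fin n)).real (wordBox x) = ((q : ℝ)⁻¹) ^ n := by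
  have h : ∀ c : Fin q, volume.restrict (Set.Icc (0 : ℝ) 1) (letterInterval c) =
      ENNReal.ofReal (q : ℝ)⁻¹ := fun c => by
    rw [Measure.restrict_apply (measurableSet_letterInterval c),
      Set.inter_eq_left.2 (letterInterval_subset c), letterInterval, Real.volume_Ico]
    congr 1
    ring
  rw [measureReal_def, cubeMeasure, wordBox, Measure.pi_pi]
  simp only [h, Finset.prod_const, Finset.card_univ, Fintype.card_fin, ENNReal.toReal_pow]
  rw [ENNReal.toReal_ofReal (by positivity)]

/-- The blow-up of a set of words that is independent in the de Bruijn graph with self-loops. -/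
theorem IsLoopIndep.exists_card_le_cubePhi_mul {m q : ℕ} {s : Finset (Fin (m + 1) → Fin q)}
    (hs : IsLoopIndep (m + 1) q s) :
    ∃ A : Set (Fin m → ℝ), A ⊆ Set.Icc 0 1 ∧ MeasurableSet A ∧
      (s.card : ℝ) ≤ cubePhi m A * (q : ℝ) ^ (m + 1) := by
  -- Prefixes alone suffice: a suffix box meeting `A` would be the prefix box of some `y ∈ s`,
  -- giving an edge inside `s`.
  let A : Set (Fin m → ℝ) := ⋃ x ∈ s, wordBox (x ∘ Fin.castSucc)
  have hA : MeasurableSet A := s.measurableSet_biUnion fun x _ => measurableSet_wordBox _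
  refine ⟨A, ?_, hA, ?_⟩
  · refine Set.iUnion₂_subset fun x _ t ht => ?_
    exact ⟨fun i => (letterInterval_subset _ (ht i trivial)).1,
      fun i => (letterInterval_subset _ (ht i trivial)).2⟩
  · rcases Nat.eq_zero_or_pos q with rfl | hq
    · have : s = ∅ := Finset.eq_empty_of_isEmpty s
      simp [this]
    have hsub : ⋃ x ∈ s, wordBox x ⊆ shiftCut A := by
      refine Set.iUnion₂_subset fun x hx t ht => ⟨?_, fun h => ?_⟩
      · exact Set.mem_biUnion hx fun i _ => ht i.castSucc trivial
      · obtain ⟨y, hy, hty⟩ := Set.mem_iUnion₂.1 h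
        have hx' : t ∘ Fin.succ ∈ wordBox (x ∘ Fin.succ) := fun i _ => ht i.succ trivial
        exact hs x hx y hy (deBruijnDigraph_adj_iff.2 (eq_of_mem_wordBox hty hx'))
    have hcard : (s.card : ℝ) * ((q : ℝ)⁻¹) ^ (m + 1) ≤ cubePhi m A := by
      rw [cubePhi_eq_measureReal_shiftCut hA.nullMeasurableSet]
      refine le_trans (le_of_eq ?_) (measureReal_mono hsub)
      rw [measureReal_biUnion_finset]
      · simp only [measureReal_wordBox, Finset.sum_const, nsmul_eq_mul]
      · intro x _ y _ hxy
        exact Set.disjoint_left.2 fun t hx hy => hxy (eq_of_mem_wordBox hx hy)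
      · exact fun x _ => measurableSet_wordBox x
    have hq' : (0 : ℝ) < (q : ℝ) ^ (m + 1) := by positivity
    rwa [inv_pow, ← div_eq_mul_inv, div_le_iff₀ hq'] at hcard

/-! ### Bounds on `λ₃` and the asymptotics -/

theorem cubeLambda_three_set_bddAbove : BddAbove {r : ℝ | ∃ A : Set (Fin 3 → ℝ),
    A ⊆ Set.Icc 0 1 ∧ NullMeasurableSet A volume ∧ cubePhi 3 A = r} := by
  refine ⟨11 / 28, ?_⟩
  rintro _ ⟨A, -, hA, rfl⟩
  exact cubePhi_three_le hA

theorem cubeLambda_three_set_nonempty : {r : ℝ | ∃ A : Set (Fin 3 → ℝ),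
    A ⊆ Set.Icc 0 1 ∧ NullMeasurableSet A volume ∧ cubePhi 3 A = r}.Nonempty :=
  ⟨_, ∅, Set.empty_subset _, nullMeasurableSet_empty, rfl⟩

theorem cubeLambda_three_le : cubeLambda 3 ≤ 11 / 28 := by
  refine csSup_le cubeLambda_three_set_nonempty ?_
  rintro _ ⟨A, -, hA, rfl⟩
  exact cubePhi_three_le hA

theorem IsLoopIndep.card_le_cubeLambda_three_mul {q : ℕ} {s : Finset (Fin 4 → Fin q)}
    (hs : IsLoopIndep 4 q s) : (s.card : ℝ) ≤ cubeLambda 3 * (q : ℝ) ^ 4 := by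
  obtain ⟨A, hA, hAm, hcard⟩ := hs.exists_card_le_cubePhi_mul
  refine hcard.trans (mul_le_mul_of_nonneg_right ?_ (by positivity))
  exact le_csSup cubeLambda_three_set_bddAbove ⟨A, hA, hAm.nullMeasurableSet, rfl⟩

theorem le_cubeLambda_three : 91 / 240 ≤ cubeLambda 3 := by
  have h := isLoopIndep_nineLetterWords.card_le_cubeLambda_three_mul
  rw [card_nineLetterWords] at h
  norm_num at h
  linarith

theorem deBruijnAlphaLoop_four_le (q : ℕ) :
    (deBruijnAlphaLoop 4 q : ℝ) ≤ cubeLambda 3 * (q : ℝ) ^ 4 := by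
  obtain ⟨s, hs, hcard⟩ := exists_isLoopIndep_card_eq_deBruijnAlphaLoop 4 q
  rw [← hcard]
  exact hs.card_le_cubeLambda_three_mul

theorem descFactorial_four_mul_cubeLambda_three_le (q : ℕ) :
    (q.descFactorial 4 : ℝ) * cubeLambda 3 ≤ deBruijnAlphaLoop 4 q := by
  rcases (q.descFactorial 4).eq_zero_or_pos with h | h
  · rw [h, Nat.cast_zero, zero_mul]
    exact Nat.cast_nonneg _
  have h' : (0 : ℝ) < q.descFactorial 4 := Nat.cast_pos.2 h
  rw [← le_div_iff₀' h']
  refine csSup_le cubeLambda_three_set_nonempty ?_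
  rintro _ ⟨A, -, hA, rfl⟩
  rw [le_div_iff₀' h']
  exact descFactorial_mul_cubePhi_le q hA

/-- The constant is `6 = 1 + 2 + 3`, from expanding `q(q-1)(q-2)(q-3)`. -/
theorem pow_four_le_descFactorial_add (q : ℕ) : q ^ 4 ≤ q.descFactorial 4 + 6 * q ^ 3 := by
  rcases q with _ | _ | _ | n
  · norm_num
  · norm_num
  · norm_num
  · simp only [Nat.descFactorial]
    have h₁ : n + 1 + 1 + 1 - 3 = n := by omega
    have h₂ : n + 1 + 1 + 1 - 2 = n + 1 := by omega
    have h₃ : n + 1 + 1 + 1 - 1 = n + 2 := by omega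
    simp only [h₁, h₂, h₃, Nat.sub_zero]
    nlinarith [Nat.zero_le n, sq_nonneg n]

theorem cubeLambda_three_mul_sub_le_deBruijnAlphaLoop_four (q : ℕ) :
    cubeLambda 3 * (q : ℝ) ^ 4 - 6 * (q : ℝ) ^ 3 ≤ deBruijnAlphaLoop 4 q := by
  have h₀ : (q : ℝ) ^ 4 ≤ q.descFactorial 4 + 6 * (q : ℝ) ^ 3 := by
    exact_mod_cast pow_four_le_descFactorial_add q
  have h₁ := descFactorial_four_mul_cubeLambda_three_le q
  have h₂ := cubeLambda_three_le
  have h₃ := le_cubeLambda_three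
  have h₄ : (0 : ℝ) ≤ (q : ℝ) ^ 3 := by positivity
  -- The bounds `0 ≤ λ₃ ≤ 1` allow multiplying `h₀` by `λ₃` and replacing `6 λ₃ q³` by `6 q³`.
  nlinarith

theorem isLittleO_pow_four_of_abs_le {f : ℕ → ℝ} (hf : ∀ q, |f q| ≤ 6 * (q : ℝ) ^ 3) :
    f =o[atTop] fun q : ℕ => (q : ℝ) ^ 4 := by
  have h₁ : f =O[atTop] fun q : ℕ => (q : ℝ) ^ 3 :=
    IsBigO.of_bound 6 (Eventually.of_forall fun q => by
      rw [Real.norm_eq_abs, Real.norm_of_nonneg (by positivity)]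
      exact hf q)
  exact h₁.trans_isLittleO
    ((isLittleO_pow_pow_atTop_of_lt (𝕜 := ℝ) (by norm_num : 3 < 4)).comp_tendsto
      tendsto_natCast_atTop_atTop)

theorem deBruijnAlphaLoop_four_sub_isLittleO :
    (fun q : ℕ => (deBruijnAlphaLoop 4 q : ℝ) - cubeLambda 3 * (q : ℝ) ^ 4)
      =o[atTop] fun q : ℕ => (q : ℝ) ^ 4 := by
  refine isLittleO_pow_four_of_abs_le fun q => abs_le.2 ⟨?_, ?_⟩
  · linarith [cubeLambda_three_mul_sub_le_deBruijnAlphaLoop_four q]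
  · have : (0 : ℝ) ≤ 6 * (q : ℝ) ^ 3 := by positivity
    linarith [deBruijnAlphaLoop_four_le q]

theorem deBruijnAlpha_four_sub_isLittleO :
    (fun q : ℕ => (deBruijnAlpha 4 q : ℝ) - cubeLambda 3 * (q : ℝ) ^ 4)
      =o[atTop] fun q : ℕ => (q : ℝ) ^ 4 := by
  refine isLittleO_pow_four_of_abs_le fun q => abs_le.2 ⟨?_, ?_⟩
  · have h : (deBruijnAlphaLoop 4 q : ℝ) ≤ deBruijnAlpha 4 q :=
      Nat.cast_le.2 (deBruijnAlphaLoop_le_deBruijnAlpha 4 q)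
    linarith [cubeLambda_three_mul_sub_le_deBruijnAlphaLoop_four q]
  · have h : (deBruijnAlpha 4 q : ℝ) ≤ deBruijnAlphaLoop 4 q + q := by
      exact_mod_cast deBruijnAlpha_le_deBruijnAlphaLoop_add 3 q
    have hq : (q : ℝ) ≤ (q : ℝ) ^ 3 := by
      exact_mod_cast Nat.le_self_pow (by norm_num : (3 : ℕ) ≠ 0) q
    have : (0 : ℝ) ≤ (q : ℝ) ^ 3 := by positivity
    linarith [deBruijnAlphaLoop_four_le q]

theorem exists_isLittleO_bounds {f : ℕ → ℝ} {a l b : ℝ} (hal : a ≤ l) (hlb : l ≤ b)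
    (hf : (fun q : ℕ => f q - l * (q : ℝ) ^ 4) =o[atTop] fun q : ℕ => (q : ℝ) ^ 4) :
    ∃ e₁ e₂ : ℕ → ℝ, (e₁ =o[atTop] fun q : ℕ => (q : ℝ) ^ 4) ∧
      (e₂ =o[atTop] fun q : ℕ => (q : ℝ) ^ 4) ∧
      ∀ q : ℕ, a * (q : ℝ) ^ 4 + e₁ q ≤ f q ∧ f q ≤ b * (q : ℝ) ^ 4 + e₂ q := by
  -- Both error terms are `f q - l * q ^ 4` itself.
  refine ⟨_, _, hf, hf, fun q => ⟨?_, ?_⟩⟩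
  · linarith [mul_le_mul_of_nonneg_right hal (by positivity : (0 : ℝ) ≤ (q : ℝ) ^ 4)]
  · linarith [mul_le_mul_of_nonneg_right hlb (by positivity : (0 : ℝ) ≤ (q : ℝ) ^ 4)]

theorem theorem3p10 :
    ((3 / 8 : ℝ) < 91 / 240 ∧ (91 / 240 : ℝ) ≤ cubeLambda 3 ∧
      cubeLambda 3 ≤ 11 / 28 ∧ (11 / 28 : ℝ) < 2 / 5) ∧
    ((fun q : ℕ => (deBruijnAlpha 4 q : ℝ) - cubeLambda 3 * (q : ℝ) ^ 4)
      =o[atTop] fun q : ℕ => (q : ℝ) ^ 4) ∧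
    ((fun q : ℕ => (deBruijnAlphaLoop 4 q : ℝ) - cubeLambda 3 * (q : ℝ) ^ 4)
      =o[atTop] fun q : ℕ => (q : ℝ) ^ 4) ∧
    (∃ e₁ e₂ : ℕ → ℝ, (e₁ =o[atTop] fun q : ℕ => (q : ℝ) ^ 4) ∧
      (e₂ =o[atTop] fun q : ℕ => (q : ℝ) ^ 4) ∧
      ∀ q : ℕ, 91 / 240 * (q : ℝ) ^ 4 + e₁ q ≤ (deBruijnAlpha 4 q : ℝ) ∧
        (deBruijnAlpha 4 q : ℝ) ≤ 11 / 28 * (q : ℝ) ^ 4 + e₂ q) ∧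
    (∃ e₁ e₂ : ℕ → ℝ, (e₁ =o[atTop] fun q : ℕ => (q : ℝ) ^ 4) ∧
      (e₂ =o[atTop] fun q : ℕ => (q : ℝ) ^ 4) ∧
      ∀ q : ℕ, 91 / 240 * (q : ℝ) ^ 4 + e₁ q ≤ (deBruijnAlphaLoop 4 q : ℝ) ∧
        (deBruijnAlphaLoop 4 q : ℝ) ≤ 11 / 28 * (q : ℝ) ^ 4 + e₂ q) := by
  exact ⟨⟨by norm_num, le_cubeLambda_three, cubeLambda_three_le, by norm_num⟩,
    deBruijnAlpha_four_sub_isLittleO, deBruijnAlphaLoop_four_sub_isLittleO,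
    exists_isLittleO_bounds le_cubeLambda_three cubeLambda_three_le
      deBruijnAlpha_four_sub_isLittleO,
    exists_isLittleO_bounds le_cubeLambda_three cubeLambda_three_le
      deBruijnAlphaLoop_four_sub_isLittleO⟩
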